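/- Let $\Sigma$ be a finite alphabet with at least two elements and let $\Sigma^\omega$ be the set of infinite strings over $\Sigma$. For a finite string $u \in \Sigma^*$ let $\Gamma_u \subseteq \Sigma^\omega$ be the cylinder set of all infinite strings with prefix $u$; for $v \in \Sigma^\omega$ let $v_{1:t}$ denote the string of the first $t$ characters of $v$. Let $\mathcal{F}_t := \sigma(\{\Gamma_u \mid u \in \Sigma^t\})$ and $\mathcal{F}_\omega := \sigma(\bigcup_t \mathcal{F}_t)$. Let $P$ be a probability measure on $(\Sigma^\omega, \mathcal{F}_\omega)$ with *perpetual entropy*, that is, there is an $\varepsilon > 0$ such that for every $u \in \Sigma^*$ and every $v \in \Sigma^\omega$ with $P(\Gamma_{u v_{1:n}}) > 0$ for all $n \ge 0$ (so in particular $P(\Gamma_u) > 0$) there are a symbol $x \in \Sigma$ and a $t \ge 0$ with \[ 1 - \varepsilon > P(\Gamma_{u v_{1:t} x} \mid \Gamma_{u v_{1:t}}) > \varepsilon . \] Then for all real numbers $b > a > 0$ there is a nonnegative $P$-martingale $(X_t)_{t \in \mathbb{N}}$ with respect to the filtration $(\mathcal{F}_t)_{t \in \mathbb{N}}$ (where $0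 \in \mathbb{N}$) with $X_0 = a$ such that \[ \mathbb{E}[U(a,b)] = \frac{a}{b-a}. \] Here $U(a,b) := \sup_{t \in \mathbb{N}} U_t(a,b)$ is the total number of upcrossings, where $U_t(a,b) := \sup\{k \ge 0 \mid T_{2k} \le t\}$, $T_0 := 0$, and for $k \ge 0$ \[ T_{2k+1} := \inf\{t > T_{2k} \mid X_t \le a\}, \qquad T_{2k+2} := \inf\{t > T_{2k+1} \mid X_t \ge b\} \] (with $\inf \emptyset := \infty$). -/

import Mathlib

open MeasureTheory ProbabilityTheory Filter
open scoped ENNReal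

/-- Infinite strings over the alphabet `S`; the first character of `v` is `v 0`. -/
def InfString (S : Type*) : Type _ := ℕ → S

namespace InfString

variable {S : Type*}

/-- `v.take t` is the finite string of the first `t` characters of `v`. -/
def take (v : InfString S) (t : ℕ) : List S := List.ofFn (fun i : Fin t => v i)

/-- The cylinder set of `u`: all infinite strings of which the finite string `u` is a prefix. -/
def cylinder (u : List S) : Set (InfString S) := {w | w.take u.length = u}

variable (S) in
/-- The σ-algebra `F_t` generated by the cylinder sets of the strings of length `t`. -/
@[reducible] def sigmaAlgebra (t : ℕ) : MeasurableSpace (InfString S) :=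
  MeasurableSpace.generateFrom {A | ∃ u : List S, u.length = t ∧ A = cylinder u}

/-- The σ-algebra `F_ω` generated by the union of all the `F_t`. -/
instance : MeasurableSpace (InfString S) := ⨆ t, sigmaAlgebra S t

theorem take_succ (v : InfString S) (t : ℕ) : v.take (t + 1) = v.take t ++ [v t] := by
  simp only [take, List.ofFn_succ_last]
  rfl

theorem cylinder_eq_iUnion (u : List S) : cylinder u = ⋃ a : S, cylinder (u ++ [a]) := by
  ext w
  simp only [cylinder, Set.mem_ofPred_eq, Set.mem_iUnion, List.length_append, List.length_singleton,
    take_succ]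
  constructor
  · intro h
    exact ⟨w u.length, by rw [h]⟩
  · rintro ⟨a, h⟩
    exact (List.append_inj' h rfl).1

variable (S) in
/-- The filtration `(F_t)` on infinite strings over a finite alphabet. -/
def filtration [Finite S] : Filtration ℕ (inferInstance : MeasurableSpace (InfString S)) where
  seq := sigmaAlgebra S
  mono' := by
    refine monotone_nat_of_le_succ fun t => MeasurableSpace.generateFrom_le ?_
    rintro _ ⟨u, rfl, rfl⟩
    rw [cylinder_eq_iUnion]
    exact @MeasurableSet.iUnion _ _ (sigmaAlgebra S (u.length + 1)) _ _ fun a =>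
      MeasurableSpace.measurableSet_generateFrom ⟨u ++ [a], by simp, rfl⟩
  le' := fun t => le_iSup (sigmaAlgebra S) t

/-- Perpetual entropy of `P`: there is a single `ε > 0` such that after every finite string `u`,
along every infinite continuation `v` all of whose prefixes have positive probability, there are a
time `t` and a symbol `a` whose conditional probability given `u v_1 … v_t` lies strictly between
`ε` and `1 - ε`. The positivity (which for `n = 0` says that `u` has positive probability) makes
every conditional probability that occurs well defined. -/
def HasPerpetualEntropy (P : Measure (InfString S)) : Prop :=
  ∃ ε : ℝ, 0 < ε ∧ ∀ (u : List S) (v : InfString S),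
    (∀ n : ℕ, 0 < P (cylinder (u ++ v.take n))) →
      ∃ (a : S) (t : ℕ),
        ε < (P[|cylinder (u ++ v.take t)]).real (cylinder (u ++ v.take t ++ [a])) ∧
        (P[|cylinder (u ++ v.take t)]).real (cylinder (u ++ v.take t ++ [a])) < 1 - ε

end InfString

/-- The crossing times `T_0 = 0`, `T_{2k+1} = inf {t > T_{2k} | X_t ≤ a}`,
`T_{2k+2} = inf {t > T_{2k+1} | X_t ≥ b}` of a process `X` at the outcome `v`, with `inf ∅ = ∞`. -/
noncomputable def crossingTime {Ω : Type*} (X : ℕ → Ω → ℝ) (a b : ℝ) (v : Ω) : ℕ → ℕ∞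
  | 0 => 0
  | k + 1 =>
    sInf {s : ℕ∞ | ∃ t : ℕ, s = (t : ℕ∞) ∧ crossingTime X a b v k < (t : ℕ∞) ∧
      (if Even k then X t v ≤ a else b ≤ X t v)}

/-- The number `U_t(a, b)` of upcrossings completed up to time `t`. -/
noncomputable def upcrossingsUpTo {Ω : Type*} (X : ℕ → Ω → ℝ) (a b : ℝ) (t : ℕ) (v : Ω) : ℕ∞ :=
  sSup {n : ℕ∞ | ∃ k : ℕ, n = (k : ℕ∞) ∧ crossingTime X a b v (2 * k) ≤ (t : ℕ∞)}

/-- The total number `U(a, b)` of upcrossings, with values in `ℕ ∪ {∞}`. -/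
noncomputable def totalUpcrossings {Ω : Type*} (X : ℕ → Ω → ℝ) (a b : ℝ) (v : Ω) : ℕ∞ :=
  ⨆ t : ℕ, upcrossingsUpTo X a b t v

/-! The martingale is the capital of a bettor who never overshoots. At each time there is an event
`A t` about the next character with conditional probability `q t ≤ 1/2`. While waiting for a
downcrossing, the bettor stakes so that `A t` brings the capital to exactly `a`. While waiting for
an upcrossing, the capital stays in `[0, b]` and `A t` brings it to `0` or to `b`. Put `R = a` in
the first phase and `R = X` in the second. As crossings land exactly on `a` and `b`, `(b - a) U_t +
R_t` changes only by martingale increments over the second phase, so its mean stays `a`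
(`integral_upcrossings_add_integral_wagerRemainder`). Hence `E[U]` is finite and crossings almost
surely stop. Perpetual entropy gives events with `q t > ε` infinitely often
(`HasPerpetualEntropy.exists_nextProb`), so by Lévy's Borel–Cantelli lemma they occur infinitely
often. One that causes no further crossing must ruin the bettor, so `R → 0`; as `0 ≤ R ≤ b`,
dominated convergence gives equality. -/

/-! ### Crossing times as a recursive counter -/

section Counting

variable {Ω : Type*}

open Classical in
/-- The number of completed crossings after observing the value `x`, if it was `k` before. -/
noncomputable def crossingStep (a b x : ℝ) (k : ℕ) : ℕ :=
  if (if Even k then x ≤ a else b ≤ x) then k + 1 else k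

/-- The number of crossings completed up to time `t`. -/
noncomputable def crossingCount (X : ℕ → Ω → ℝ) (a b : ℝ) (v : Ω) : ℕ → ℕ
  | 0 => 0
  | t + 1 => crossingStep a b (X (t + 1) v) (crossingCount X a b v t)

theorem crossingStep_of_even {a b x : ℝ} {k : ℕ} (hk : Even k) :
    crossingStep a b x k = if x ≤ a then k + 1 else k := by
  simp [crossingStep, hk]

theorem crossingStep_of_not_even {a b x : ℝ} {k : ℕ} (hk : ¬ Even k) :
    crossingStep a b x k = if b ≤ x then k + 1 else k := by
  simp [crossingStep, hk]

theorem le_crossingStep (a b x : ℝ) (k : ℕ) : k ≤ crossingStep a b x k := by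
  unfold crossingStep; split_ifs <;> omega

theorem crossingStep_le (a b x : ℝ) (k : ℕ) : crossingStep a b x k ≤ k + 1 := by
  unfold crossingStep; split_ifs <;> omega

theorem crossingCount_mono (X : ℕ → Ω → ℝ) (a b : ℝ) (v : Ω) : Monotone (crossingCount X a b v) :=
  monotone_nat_of_le_succ fun _ => le_crossingStep _ _ _ _

theorem crossingCount_le (X : ℕ → Ω → ℝ) (a b : ℝ) (v : Ω) (t : ℕ) :
    crossingCount X a b v t ≤ t := by
  induction t with
  | zero => exact le_rfl
  | succ t ih => exact (crossingStep_le _ _ _ _).trans (by omega)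

theorem crossingTime_succ_le_iff (X : ℕ → Ω → ℝ) (a b : ℝ) (v : Ω) (k t : ℕ) :
    crossingTime X a b v (k + 1) ≤ (t : ℕ∞) ↔
      ∃ s : ℕ, s ≤ t ∧ crossingTime X a b v k < (s : ℕ∞) ∧
        (if Even k then X s v ≤ a else b ≤ X s v) := by
  rw [crossingTime]
  constructor
  · intro h
    have hne : {s : ℕ∞ | ∃ t : ℕ, s = (t : ℕ∞) ∧ crossingTime X a b v k < (t : ℕ∞) ∧
        (if Even k then X t v ≤ a else b ≤ X t v)}.Nonempty := by
      rw [Set.nonempty_iff_ne_empty]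
      intro he
      rw [he, sInf_empty] at h
      simp at h
    obtain ⟨s, hs, hlt, hc⟩ := csInf_mem hne
    rw [hs] at h
    exact ⟨s, by exact_mod_cast h, hlt, hc⟩
  · rintro ⟨s, hst, hlt, hc⟩
    exact le_trans (b := (s : ℕ∞)) (sInf_le ⟨s, rfl, hlt, hc⟩) (by exact_mod_cast hst)

/-- The strict inequality between successive crossing times allows at most one crossing per time
step, so a counter moving by at most one records them all. -/
theorem crossingTime_le_iff (X : ℕ → Ω → ℝ) (a b : ℝ) (v : Ω) (k t : ℕ) :
    crossingTime X a b v k ≤ (t : ℕ∞) ↔ k ≤ crossingCount X a b v t := by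
  induction t generalizing k with
  | zero =>
    cases k with
    | zero => simp [crossingTime]
    | succ k =>
      rw [crossingTime_succ_le_iff]
      simp only [crossingCount]
      constructor
      · rintro ⟨s, hs, hlt, -⟩
        obtain rfl : s = 0 := by omega
        simp at hlt
      · intro h; omega
  | succ t ih =>
    cases k with
    | zero => simp [crossingTime]
    | succ k =>
      have h1 : crossingTime X a b v (k + 1) ≤ ((t + 1 : ℕ) : ℕ∞) ↔
          crossingTime X a b v (k + 1) ≤ (t : ℕ∞) ∨ (crossingTime X a b v k ≤ (t : ℕ∞) ∧
            (if Even k then X (t + 1) v ≤ a else b ≤ X (t + 1) v)) := by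
        have h2 : crossingTime X a b v k < ((t + 1 : ℕ) : ℕ∞) ↔
            crossingTime X a b v k ≤ (t : ℕ∞) := by
          push_cast
          exact ENat.lt_add_one_iff (ENat.natCast_ne_top t)
        rw [crossingTime_succ_le_iff, crossingTime_succ_le_iff]
        constructor
        · rintro ⟨s, hs, hlt, hc⟩
          rcases hs.lt_or_eq with h | rfl
          · exact Or.inl ⟨s, by omega, hlt, hc⟩
          · exact Or.inr ⟨h2.1 hlt, hc⟩
        · rintro (⟨s, hs, hlt, hc⟩ | ⟨hlt, hc⟩)
          · exact ⟨s, by omega, hlt, hc⟩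
          · exact ⟨t + 1, le_rfl, h2.2 hlt, hc⟩
      rw [h1, ih, ih]
      simp only [crossingCount]
      generalize crossingCount X a b v t = n
      -- Only crossing `n + 1` is decided at this step: earlier ones are already complete, later
      -- ones still impossible.
      by_cases hkn : k = n
      · subst hkn
        unfold crossingStep
        split_ifs <;> simp_all
      · have := le_crossingStep a b (X (t + 1) v) n
        have := crossingStep_le a b (X (t + 1) v) n
        constructor
        · rintro (h | ⟨h, -⟩) <;> omega
        · intro h; left; omega

theorem upcrossingsUpTo_eq (X : ℕ → Ω → ℝ) (a b : ℝ) (t : ℕ) (v : Ω) :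
    upcrossingsUpTo X a b t v = ((crossingCount X a b v t / 2 : ℕ) : ℕ∞) := by
  apply le_antisymm
  · refine sSup_le ?_
    rintro _ ⟨k, rfl, hk⟩
    rw [crossingTime_le_iff] at hk
    exact_mod_cast (by omega : k ≤ crossingCount X a b v t / 2)
  · refine le_sSup ⟨_, rfl, ?_⟩
    rw [crossingTime_le_iff]
    omega

theorem totalUpcrossings_toENNReal (X : ℕ → Ω → ℝ) (a b : ℝ) (v : Ω) :
    (totalUpcrossings X a b v : ℝ≥0∞) = ⨆ t, ((crossingCount X a b v t / 2 : ℕ) : ℝ≥0∞) := by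
  simp [totalUpcrossings, upcrossingsUpTo_eq, ENat.toENNReal_iSup]

theorem measurable_crossingStep (a b : ℝ) :
    Measurable fun p : ℝ × ℕ => crossingStep a b p.1 p.2 := by
  refine measurable_from_prod_countable_left fun k => ?_
  by_cases hk : Even k
  · simp only [crossingStep_of_even hk]
    exact Measurable.ite measurableSet_Iic measurable_const measurable_const
  · simp only [crossingStep_of_not_even hk]
    exact Measurable.ite measurableSet_Ici measurable_const measurable_const

end Counting

/-! ### The betting strategy and its martingale property -/

section Wager

variable {Ω : Type*}

/-- The value to which the bettor moves if the next event occurs: a capital waiting for a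
downcrossing moves to `a`, one waiting for an upcrossing is lost or moves to `b`. -/
noncomputable def wagerTarget (a b q x : ℝ) (k : ℕ) : ℝ :=
  if Even k then a else if x ≤ (1 - q) * b then 0 else b

/-- The capital of the bettor together with the number of crossings it has completed. -/
noncomputable def wagerState (A : ℕ → Set Ω) (q : ℕ → Ω → ℝ) (a b : ℝ) (v : Ω) : ℕ → ℝ × ℕ
  | 0 => (a, 0)
  | t + 1 =>
    let p := wagerState A q a b v t
    let x := p.1 + ((A t).indicator 1 v - q t v) *
      ((wagerTarget a b (q t v) p.1 p.2 - p.1) / (1 - q t v))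
    (x, crossingStep a b x p.2)

/-- The capital of the bettor at time `t`. -/
noncomputable def wager (A : ℕ → Set Ω) (q : ℕ → Ω → ℝ) (a b : ℝ) (t : ℕ) (v : Ω) : ℝ :=
  (wagerState A q a b v t).1

theorem crossingCount_wager (A : ℕ → Set Ω) (q : ℕ → Ω → ℝ) (a b : ℝ) (t : ℕ) (v : Ω) :
    crossingCount (wager A q a b) a b v t = (wagerState A q a b v t).2 := by
  induction t with
  | zero => rfl
  | succ t ih => rw [crossingCount, ih]; rfl

/-- The stake of the bettor on the event `A t`. -/
noncomputable def stake (A : ℕ → Set Ω) (q : ℕ → Ω → ℝ) (a b : ℝ) (t : ℕ) (v : Ω) : ℝ :=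
  (wagerTarget a b (q t v) (wager A q a b t v) (crossingCount (wager A q a b) a b v t) -
    wager A q a b t v) / (1 - q t v)

theorem wager_succ (A : ℕ → Set Ω) (q : ℕ → Ω → ℝ) (a b : ℝ) (t : ℕ) (v : Ω) :
    wager A q a b (t + 1) v =
      wager A q a b t v + ((A t).indicator 1 v - q t v) * stake A q a b t v := by
  rw [stake, crossingCount_wager]; rfl

theorem measurable_wagerTarget (a b : ℝ) :
    Measurable fun p : (ℝ × ℝ) × ℕ => wagerTarget a b p.1.1 p.1.2 p.2 := by
  refine measurable_from_prod_countable_left fun k => ?_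
  unfold wagerTarget
  by_cases hk : Even k
  · simp only [hk, if_true]; exact measurable_const
  · simp only [hk, if_false]
    exact Measurable.ite (measurableSet_le measurable_snd (by fun_prop)) measurable_const
      measurable_const

variable {m0 : MeasurableSpace Ω} {ℱ : Filtration ℕ m0} {A : ℕ → Set Ω} {q : ℕ → Ω → ℝ} {a b : ℝ}

theorem measurable_wager_crossingCount (hA : ∀ t, MeasurableSet[ℱ (t + 1)] (A t))
    (hq : ∀ t, Measurable[ℱ t] (q t)) (t : ℕ) :
    Measurable[ℱ t] (wager A q a b t) ∧
      Measurable[ℱ t] fun v => crossingCount (wager A q a b) a b v t := by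
  induction t with
  | zero => exact ⟨measurable_const, measurable_const⟩
  | succ t ih =>
    have hle : ℱ t ≤ ℱ (t + 1) := ℱ.mono t.le_succ
    have hx := ih.1.mono hle le_rfl
    have hk := ih.2.mono hle le_rfl
    have hq' := (hq t).mono hle le_rfl
    have h1 : Measurable[ℱ (t + 1)] (wager A q a b (t + 1)) := by
      have : wager A q a b (t + 1) = fun v => wager A q a b t v +
          ((A t).indicator 1 v - q t v) * stake A q a b t v := funext fun v => wager_succ ..
      rw [this]
      unfold stake
      have hi : Measurable[ℱ (t + 1)] ((A t).indicator (1 : Ω → ℝ)) :=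
        (@measurable_const _ _ _ (ℱ (t + 1)) (1 : ℝ)).indicator (hA t)
      exact hx.add ((hi.sub hq').mul
        ((((measurable_wagerTarget a b).comp ((hq'.prodMk hx).prodMk hk)).sub hx).div
          (measurable_const.sub hq')))
    exact ⟨h1, (measurable_crossingStep a b).comp (h1.prodMk hk)⟩

theorem measurable_stake (hA : ∀ t, MeasurableSet[ℱ (t + 1)] (A t))
    (hq : ∀ t, Measurable[ℱ t] (q t)) (t : ℕ) : Measurable[ℱ t] (stake A q a b t) := by
  obtain ⟨hx, hk⟩ := measurable_wager_crossingCount (a := a) (b := b) hA hq t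
  unfold stake
  exact (((measurable_wagerTarget a b).comp (((hq t).prodMk hx).prodMk hk)).sub hx).div
    (measurable_const.sub (hq t))

theorem wager_succ_of_mem (hq1 : ∀ t v, q t v ≤ 1 / 2) {t : ℕ} {v : Ω} (hv : v ∈ A t) :
    wager A q a b (t + 1) v = wagerTarget a b (q t v) (wager A q a b t v)
      (crossingCount (wager A q a b) a b v t) := by
  have : 1 - q t v ≠ 0 := by linarith [hq1 t v]
  rw [wager_succ, stake, Set.indicator_of_mem hv, Pi.one_apply]
  field_simp
  ring

/-- Fairness: `q` times the value on `A t` plus `1 - q` times the value off it is the old capital.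
-/
theorem wager_succ_of_notMem (hq1 : ∀ t v, q t v ≤ 1 / 2) {t : ℕ} {v : Ω} (hv : v ∉ A t) :
    (1 - q t v) * wager A q a b (t + 1) v = wager A q a b t v - q t v *
      wagerTarget a b (q t v) (wager A q a b t v) (crossingCount (wager A q a b) a b v t) := by
  have : 1 - q t v ≠ 0 := by linarith [hq1 t v]
  rw [wager_succ, stake, Set.indicator_of_notMem hv]
  field_simp
  ring

theorem wager_succ_ge_of_even (hq0 : ∀ t v, 0 ≤ q t v) (hq1 : ∀ t v, q t v ≤ 1 / 2)
    {t : ℕ} {v : Ω} (hk : Even (crossingCount (wager A q a b) a b v t))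
    (hx : a ≤ wager A q a b t v) : a ≤ wager A q a b (t + 1) v := by
  have h1 := hq1 t v
  have h0 := hq0 t v
  by_cases hv : v ∈ A t
  · rw [wager_succ_of_mem hq1 hv, wagerTarget, if_pos hk]
  · have h := wager_succ_of_notMem (a := a) (b := b) hq1 hv
    rw [wagerTarget, if_pos hk] at h
    have : (1 - q t v) * a ≤ (1 - q t v) * wager A q a b (t + 1) v := by rw [h]; linarith
    exact le_of_mul_le_mul_left this (by linarith)

/-- The threshold `(1 - q) b` prevents overshooting. Below it, missing `A t` multiplies the capital
by `1 / (1 - q)`, giving at most `b`; above it, `q ≤ 1/2` makes the capital exceed `q b`, so aiming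
at `b` is affordable. -/
theorem wager_succ_mem_Icc_of_odd (hb : 0 < b) (hq0 : ∀ t v, 0 ≤ q t v)
    (hq1 : ∀ t v, q t v ≤ 1 / 2)
    {t : ℕ} {v : Ω} (hk : ¬ Even (crossingCount (wager A q a b) a b v t))
    (hx : wager A q a b t v ∈ Set.Icc 0 b) : wager A q a b (t + 1) v ∈ Set.Icc 0 b := by
  have h1 := hq1 t v
  have h0 := hq0 t v
  obtain ⟨hx0, hx1⟩ := hx
  by_cases hv : v ∈ A t
  · rw [wager_succ_of_mem hq1 hv, wagerTarget, if_neg hk]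
    split_ifs
    · exact ⟨le_rfl, hb.le⟩
    · exact ⟨hb.le, le_rfl⟩
  · have h := wager_succ_of_notMem (a := a) (b := b) hq1 hv
    rw [wagerTarget, if_neg hk] at h
    have hpos : 0 < 1 - q t v := by linarith
    have : (1 - q t v) * 0 ≤ (1 - q t v) * wager A q a b (t + 1) v ∧
        (1 - q t v) * wager A q a b (t + 1) v ≤ (1 - q t v) * b := by
      rw [h]
      split_ifs with hc
      · constructor <;> linarith
      · push Not at hc
        constructor
        · nlinarith
        · nlinarith
    exact ⟨le_of_mul_le_mul_left this.1 hpos, le_of_mul_le_mul_left this.2 hpos⟩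

theorem wager_invariant (ha : 0 < a) (hab : a < b) (hq0 : ∀ t v, 0 ≤ q t v)
    (hq1 : ∀ t v, q t v ≤ 1 / 2) (t : ℕ) (v : Ω) :
    if Even (crossingCount (wager A q a b) a b v t) then a ≤ wager A q a b t v
      else wager A q a b t v ∈ Set.Icc 0 b := by
  induction t with
  | zero =>
    rw [if_pos (by simp [crossingCount])]
    exact le_rfl
  | succ t ih =>
    rw [crossingCount]
    by_cases hk : Even (crossingCount (wager A q a b) a b v t)
    · rw [if_pos hk] at ih
      have hge := wager_succ_ge_of_even hq0 hq1 hk ih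
      rw [crossingStep_of_even hk]
      by_cases hx : wager A q a b (t + 1) v ≤ a
      · rw [if_pos hx, if_neg (by simpa [Nat.even_add_one] using hk)]
        exact ⟨by linarith, by linarith⟩
      · rw [if_neg hx, if_pos hk]
        exact hge
    · rw [if_neg hk] at ih
      have hm := wager_succ_mem_Icc_of_odd (by linarith) hq0 hq1 hk ih
      rw [crossingStep_of_not_even hk]
      by_cases hx : b ≤ wager A q a b (t + 1) v
      · rw [if_pos hx, if_pos (by simpa [Nat.even_add_one] using hk)]
        linarith
      · rw [if_neg hx, if_neg hk]
        exact hm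

theorem wager_nonneg (ha : 0 < a) (hab : a < b) (hq0 : ∀ t v, 0 ≤ q t v)
    (hq1 : ∀ t v, q t v ≤ 1 / 2) (t : ℕ) (v : Ω) : 0 ≤ wager A q a b t v := by
  have h := wager_invariant (A := A) ha hab hq0 hq1 t v
  split_ifs at h with hk
  · linarith
  · exact h.1

/-- The factor `2` bounds `1 / (1 - q t v)`. -/
theorem abs_stake_le (hab : a < b) (ha : 0 < a) (hq1 : ∀ t v, q t v ≤ 1 / 2) (t : ℕ) (v : Ω) :
    |stake A q a b t v| ≤ 2 * (b + |wager A q a b t v|) := by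
  have h1 := hq1 t v
  rw [stake, abs_div, abs_of_pos (by linarith : 0 < 1 - q t v), div_le_iff₀ (by linarith)]
  set w := wagerTarget a b (q t v) (wager A q a b t v) (crossingCount (wager A q a b) a b v t)
  have hw : |w| ≤ b := by
    simp only [w, wagerTarget]
    split_ifs
    · rw [abs_of_pos ha]; exact hab.le
    · simp; linarith
    · rw [abs_of_pos (by linarith)]
  have := abs_sub w (wager A q a b t v)
  have := abs_nonneg (wager A q a b t v)
  nlinarith

theorem exists_abs_wager_le (ha : 0 < a) (hab : a < b) (hq0 : ∀ t v, 0 ≤ q t v)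
    (hq1 : ∀ t v, q t v ≤ 1 / 2) (t : ℕ) : ∃ C, ∀ v, |wager A q a b t v| ≤ C := by
  induction t with
  | zero => exact ⟨|a|, fun v => le_rfl⟩
  | succ t ih =>
    obtain ⟨C, hC⟩ := ih
    refine ⟨C + 1 * (2 * (b + C)), fun v => ?_⟩
    rw [wager_succ]
    refine (abs_add_le _ _).trans (add_le_add (hC v) ?_)
    rw [abs_mul]
    refine mul_le_mul ?_ ((abs_stake_le hab ha hq1 t v).trans (by linarith [hC v]))
      (abs_nonneg _) zero_le_one
    have h1 := hq1 t v
    have h0 := hq0 t v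
    by_cases hv : v ∈ A t
    · rw [Set.indicator_of_mem hv, Pi.one_apply, abs_le]; constructor <;> linarith
    · rw [Set.indicator_of_notMem hv, abs_le]; constructor <;> linarith

variable {P : Measure Ω} [IsProbabilityMeasure P]

theorem integrable_wager (ha : 0 < a) (hab : a < b) (hA : ∀ t, MeasurableSet[ℱ (t + 1)] (A t))
    (hq : ∀ t, Measurable[ℱ t] (q t)) (hq0 : ∀ t v, 0 ≤ q t v)
    (hq1 : ∀ t v, q t v ≤ 1 / 2) (t : ℕ) : Integrable (wager A q a b t) P := by
  obtain ⟨C, hC⟩ := exists_abs_wager_le (A := A) ha hab hq0 hq1 t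
  exact Integrable.of_bound (((measurable_wager_crossingCount hA hq t).1.mono (ℱ.le t)
    le_rfl).aestronglyMeasurable) C (ae_of_all _ hC)

/-- Each increment is an `ℱ t`-measurable stake times the centred indicator of `A t`. -/
theorem martingale_wager (ha : 0 < a) (hab : a < b) (hA : ∀ t, MeasurableSet[ℱ (t + 1)] (A t))
    (hq : ∀ t, Measurable[ℱ t] (q t)) (hq0 : ∀ t v, 0 ≤ q t v)
    (hq1 : ∀ t v, q t v ≤ 1 / 2)
    (hP : ∀ t, P[(A t).indicator 1 | ℱ t] =ᵐ[P] q t) : Martingale (wager A q a b) ℱ P := by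
  refine martingale_of_condExp_sub_eq_zero_nat
    (fun t => (measurable_wager_crossingCount hA hq t).1.stronglyMeasurable)
    (integrable_wager ha hab hA hq hq0 hq1) fun t => ?_
  have hsub : wager A q a b (t + 1) - wager A q a b t =
      stake A q a b t * ((A t).indicator 1 - q t) := by
    ext v
    simp only [Pi.sub_apply, Pi.mul_apply, wager_succ]
    ring
  have hIA : Integrable ((A t).indicator (1 : Ω → ℝ)) P :=
    (integrable_const (1 : ℝ)).indicator (ℱ.le _ _ (hA t))
  have hIq : Integrable (q t) P :=
    Integrable.of_bound ((hq t).mono (ℱ.le t) le_rfl).aestronglyMeasurable (1 / 2)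
      (ae_of_all _ fun v => by rw [Real.norm_of_nonneg (hq0 t v)]; exact hq1 t v)
  have hI : Integrable (stake A q a b t * ((A t).indicator 1 - q t)) P := by
    rw [← hsub]
    exact (integrable_wager ha hab hA hq hq0 hq1 _).sub (integrable_wager ha hab hA hq hq0 hq1 _)
  rw [hsub]
  filter_upwards [condExp_mul_of_stronglyMeasurable_left
    (measurable_stake (a := a) (b := b) hA hq t).stronglyMeasurable hI (hIA.sub hIq),
    condExp_sub hIA hIq (ℱ t), hP t] with v h1 h2 h3
  rw [h1, Pi.mul_apply, h2, Pi.sub_apply, h3,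
    condExp_of_stronglyMeasurable (ℱ.le t) (hq t).stronglyMeasurable hIq]
  simp

end Wager

/-! ### Equality in the upcrossing inequality -/

section WagerUpcrossings

variable {Ω : Type*} {m0 : MeasurableSpace Ω} {ℱ : Filtration ℕ m0} {A : ℕ → Set Ω}
  {q : ℕ → Ω → ℝ} {a b : ℝ}

/-- `b - a` times the expected number of upcrossings that are still to come. -/
noncomputable def wagerRemainder (A : ℕ → Set Ω) (q : ℕ → Ω → ℝ) (a b : ℝ) (t : ℕ) (v : Ω) : ℝ :=
  if Even (crossingCount (wager A q a b) a b v t) then a else wager A q a b t v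

theorem wagerRemainder_mem_Icc (ha : 0 < a) (hab : a < b) (hq0 : ∀ t v, 0 ≤ q t v)
    (hq1 : ∀ t v, q t v ≤ 1 / 2) (t : ℕ) (v : Ω) : wagerRemainder A q a b t v ∈ Set.Icc 0 b := by
  have h := wager_invariant (A := A) ha hab hq0 hq1 t v
  unfold wagerRemainder
  split_ifs at h ⊢
  · exact ⟨ha.le, hab.le⟩
  · exact h

theorem measurable_wagerRemainder (hA : ∀ t, MeasurableSet[ℱ (t + 1)] (A t))
    (hq : ∀ t, Measurable[ℱ t] (q t)) (t : ℕ) : Measurable[ℱ t] (wagerRemainder A q a b t) := by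
  obtain ⟨hx, hk⟩ := measurable_wager_crossingCount (a := a) (b := b) hA hq t
  exact Measurable.ite (hk (MeasurableSet.of_discrete (s := {n | Even n}))) measurable_const hx

/-- A downcrossing lands on `a`, leaving the remainder unchanged; an upcrossing lands on `b`, where
the remainder resets to `a` and the loss `b - a` is credited to the count. -/
theorem upcrossings_add_wagerRemainder_succ (ha : 0 < a) (hab : a < b) (hq0 : ∀ t v, 0 ≤ q t v)
    (hq1 : ∀ t v, q t v ≤ 1 / 2) (t : ℕ) (v : Ω) :
    (b - a) * ((crossingCount (wager A q a b) a b v (t + 1) / 2 : ℕ) : ℝ) +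
        wagerRemainder A q a b (t + 1) v =
      (b - a) * ((crossingCount (wager A q a b) a b v t / 2 : ℕ) : ℝ) +
        wagerRemainder A q a b t v +
        {v | ¬ Even (crossingCount (wager A q a b) a b v t)}.indicator
          (fun v => wager A q a b (t + 1) v - wager A q a b t v) v := by
  have h := wager_invariant (A := A) ha hab hq0 hq1 t v
  unfold wagerRemainder
  rw [crossingCount]
  by_cases hk : Even (crossingCount (wager A q a b) a b v t)
  · rw [Set.indicator_of_notMem (by simpa using hk), crossingStep_of_even hk]
    rw [if_pos hk] at h
    have hge := wager_succ_ge_of_even hq0 hq1 hk h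
    by_cases hx : wager A q a b (t + 1) v ≤ a
    · have hk' : ¬ Even (crossingCount (wager A q a b) a b v t + 1) := by
        simpa [Nat.even_add_one] using hk
      have h2 : (crossingCount (wager A q a b) a b v t + 1) / 2 =
        crossingCount (wager A q a b) a b v t / 2 := by grind
      rw [if_pos hx, if_neg hk', if_pos hk, h2, le_antisymm hx hge]
      ring
    · rw [if_neg hx, if_pos hk, if_pos hk]
      ring
  · rw [Set.indicator_of_mem (by simpa using hk), crossingStep_of_not_even hk]
    rw [if_neg hk] at h
    have hm := wager_succ_mem_Icc_of_odd (by linarith) hq0 hq1 hk h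
    by_cases hx : b ≤ wager A q a b (t + 1) v
    · have hk' : Even (crossingCount (wager A q a b) a b v t + 1) := by
        simpa [Nat.even_add_one] using hk
      have h2 : (crossingCount (wager A q a b) a b v t + 1) / 2 =
        crossingCount (wager A q a b) a b v t / 2 + 1 := by grind
      rw [if_pos hx, if_neg hk, if_pos hk', h2, le_antisymm hm.2 hx]
      push_cast
      ring
    · rw [if_neg hx, if_neg hk, if_neg hk]
      ring

variable {P : Measure Ω} [IsProbabilityMeasure P]

theorem integrable_upcrossings (hA : ∀ t, MeasurableSet[ℱ (t + 1)] (A t))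
    (hq : ∀ t, Measurable[ℱ t] (q t)) (t : ℕ) :
    Integrable (fun v => ((crossingCount (wager A q a b) a b v t / 2 : ℕ) : ℝ)) P := by
  refine Integrable.of_bound (C := t) ?_ (ae_of_all _ fun v => ?_)
  · exact ((Measurable.of_discrete (f := fun n : ℕ => ((n / 2 : ℕ) : ℝ))).comp
      ((measurable_wager_crossingCount hA hq t).2.mono (ℱ.le t) le_rfl)).aestronglyMeasurable
  · rw [Real.norm_of_nonneg (Nat.cast_nonneg _)]
    exact Nat.cast_le.2 ((Nat.div_le_self _ _).trans (crossingCount_le _ _ _ _ _))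

theorem integrable_wagerRemainder (ha : 0 < a) (hab : a < b)
    (hA : ∀ t, MeasurableSet[ℱ (t + 1)] (A t))
    (hq : ∀ t, Measurable[ℱ t] (q t)) (hq0 : ∀ t v, 0 ≤ q t v)
    (hq1 : ∀ t v, q t v ≤ 1 / 2) (t : ℕ) : Integrable (wagerRemainder A q a b t) P := by
  refine Integrable.of_bound (C := b) ((measurable_wagerRemainder hA hq t).mono (ℱ.le t)
    le_rfl).aestronglyMeasurable (ae_of_all _ fun v => ?_)
  have h := wagerRemainder_mem_Icc (A := A) ha hab hq0 hq1 t v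
  rw [Real.norm_of_nonneg h.1]
  exact h.2

/-- The phase is known at time `t`, so the martingale increment integrates to zero over it. -/
theorem integral_upcrossings_add_integral_wagerRemainder (ha : 0 < a) (hab : a < b)
    (hA : ∀ t, MeasurableSet[ℱ (t + 1)] (A t))
    (hq : ∀ t, Measurable[ℱ t] (q t)) (hq0 : ∀ t v, 0 ≤ q t v)
    (hq1 : ∀ t v, q t v ≤ 1 / 2)
    (hP : ∀ t, P[(A t).indicator 1 | ℱ t] =ᵐ[P] q t) (t : ℕ) :
    (b - a) * ∫ v, ((crossingCount (wager A q a b) a b v t / 2 : ℕ) : ℝ) ∂P +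
      ∫ v, wagerRemainder A q a b t v ∂P = a := by
  have hIU := fun t => (integrable_upcrossings (P := P) (a := a) (b := b) hA hq t).const_mul (b - a)
  have hIR := fun t => integrable_wagerRemainder (P := P) ha hab hA hq hq0 hq1 t
  have key : ∀ t, ∫ v, ((b - a) * ((crossingCount (wager A q a b) a b v t / 2 : ℕ) : ℝ) +
      wagerRemainder A q a b t v) ∂P = a := by
    intro t
    induction t with
    | zero => simp [crossingCount, wagerRemainder]
    | succ t ih =>
      have hm := martingale_wager (P := P) ha hab hA hq hq0 hq1 hP
      have hs : MeasurableSet[ℱ t] {v | ¬ Even (crossingCount (wager A q a b) a b v t)} :=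
        (measurable_wager_crossingCount hA hq t).2
          (MeasurableSet.of_discrete (s := {n | ¬ Even n}))
      have hd : Integrable (fun v => wager A q a b (t + 1) v - wager A q a b t v) P :=
        (integrable_wager ha hab hA hq hq0 hq1 _).sub (integrable_wager ha hab hA hq hq0 hq1 _)
      simp_rw [upcrossings_add_wagerRemainder_succ ha hab hq0 hq1 t]
      have hadd := integral_add ((hIU t).add (hIR t)) (hd.indicator (ℱ.le _ _ hs))
      simp only [Pi.add_apply] at hadd
      rw [hadd, ih, integral_indicator (ℱ.le _ _ hs),
        integral_sub (integrable_wager ha hab hA hq hq0 hq1 _).integrableOn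
          (integrable_wager ha hab hA hq hq0 hq1 _).integrableOn,
        hm.setIntegral_eq t.le_succ hs]
      ring
  rw [← integral_const_mul, ← integral_add (hIU t) (hIR t)]
  exact key t

/-- If the events bet on occur infinitely often and the number of crossings stays bounded, then the
bettor ends up with nothing. -/
theorem wagerRemainder_tendsto_zero (ha : 0 < a) (hab : a < b)
    (hq1 : ∀ t v, q t v ≤ 1 / 2) {v : Ω} (hv : ∃ᶠ t in atTop, v ∈ A t)
    {n : ℕ} (hn : ∀ t, crossingCount (wager A q a b) a b v t ≤ n) :
    Tendsto (fun t => wagerRemainder A q a b t v) atTop (nhds 0) := by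
  obtain ⟨T, hT⟩ : ∃ T, ∀ t, T ≤ t → crossingCount (wager A q a b) a b v t =
      crossingCount (wager A q a b) a b v T := by
    have hne : (Set.range (crossingCount (wager A q a b) a b v)).Nonempty := Set.range_nonempty _
    have hbdd : BddAbove (Set.range (crossingCount (wager A q a b) a b v)) :=
      ⟨n, by rintro _ ⟨t, rfl⟩; exact hn t⟩
    obtain ⟨T, hT⟩ := Nat.sSup_mem hne hbdd
    exact ⟨T, fun t ht => le_antisymm (hT ▸ le_csSup hbdd ⟨t, rfl⟩) (crossingCount_mono _ _ _ _ ht)⟩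
  -- After the last crossing, an event bet on can move the capital neither to `a` in the even phase
  -- nor to `b` in the odd one; only ruin is left.
  obtain ⟨t, htT, ht⟩ := (hv.and_eventually (eventually_ge_atTop T)).exists.imp
    fun _ h => And.symm h
  have hstep : crossingStep a b (wager A q a b (t + 1) v)
      (crossingCount (wager A q a b) a b v t) = crossingCount (wager A q a b) a b v t :=
    (hT (t + 1) (by omega)).trans (hT t htT).symm
  have hw := wager_succ_of_mem (a := a) (b := b) hq1 ht
  have hodd : ¬ Even (crossingCount (wager A q a b) a b v t) := by
    intro hk
    rw [wagerTarget, if_pos hk] at hw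
    rw [crossingStep_of_even hk, if_pos hw.le] at hstep
    omega
  have hzero : wager A q a b (t + 1) v = 0 := by
    rw [wagerTarget, if_neg hodd] at hw
    split_ifs at hw
    · exact hw
    · rw [crossingStep_of_not_even hodd, if_pos hw.ge] at hstep
      omega
  have hodd' : ∀ s, t + 1 ≤ s → ¬ Even (crossingCount (wager A q a b) a b v s) := by
    intro s hs
    rwa [hT s (by omega), ← hT t htT]
  have hzero' : ∀ s, t + 1 ≤ s → wager A q a b s v = 0 := by
    intro s hs
    induction s, hs using Nat.le_induction with
    | base => exact hzero
    | succ s hs ih =>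
      -- Capital `0` is below the threshold, so the target is again `0` and the stake vanishes.
      have : 0 ≤ (1 - q s v) * b := mul_nonneg (by linarith [hq1 s v]) (by linarith)
      rw [wager_succ, stake, wagerTarget, if_neg (hodd' s hs), ih, if_pos this]
      simp
  refine tendsto_const_nhds.congr' ?_
  filter_upwards [eventually_ge_atTop (t + 1)] with s hs
  rw [wagerRemainder, if_neg (hodd' s hs), hzero' s hs]

theorem ae_frequently_mem_of_frequently_lt (hA : ∀ t, MeasurableSet[ℱ (t + 1)] (A t))
    (hq0 : ∀ t v, 0 ≤ q t v) (hP : ∀ t, P[(A t).indicator 1 | ℱ t] =ᵐ[P] q t) {ε : ℝ} (hε : 0 < ε)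
    (hfreq : ∀ᵐ v ∂P, ∃ᶠ t in atTop, ε < q t v) : ∀ᵐ v ∂P, ∃ᶠ t in atTop, v ∈ A t := by
  -- The shift aligns indices: Lévy's lemma takes `s n` in `ℱ n`, whereas `A n` lies in `ℱ (n + 1)`.
  let s : ℕ → Set Ω := fun n => Nat.casesOn n ∅ A
  have hs : ∀ n, MeasurableSet[ℱ n] (s n) := by
    rintro (_ | n)
    · exact @MeasurableSet.empty _ (ℱ 0)
    · exact hA n
  filter_upwards [ae_mem_limsup_atTop_iff P hs, ae_all_iff.2 hP, hfreq] with v h1 h2 h3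
  have h4 : ¬ Summable fun t => q t v := by
    intro h
    exact h3 ((h.tendsto_atTop_zero.eventually (eventually_lt_nhds hε)).mono fun t ht => by
      exact not_lt.2 ht.le)
  rw [not_summable_iff_tendsto_nat_atTop_of_nonneg (fun t => hq0 t v)] at h4
  have h5 : v ∈ limsup s atTop := by
    rw [h1]
    refine h4.congr fun n => Finset.sum_congr rfl fun t _ => ?_
    exact (h2 t).symm
  rw [mem_limsup_iff_frequently_mem] at h5
  rw [frequently_atTop] at h5 ⊢
  intro N
  obtain ⟨n, hn, hv⟩ := h5 (N + 1)
  obtain ⟨m, rfl⟩ : ∃ m, n = m + 1 := ⟨n - 1, by omega⟩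
  exact ⟨m, by omega, hv⟩

/-- A bettor who infinitely often can bet on an event whose conditional probability is bounded away
from `0` attains equality in the upcrossing inequality. -/
theorem lintegral_totalUpcrossings_wager (ha : 0 < a) (hab : a < b)
    (hA : ∀ t, MeasurableSet[ℱ (t + 1)] (A t))
    (hq : ∀ t, Measurable[ℱ t] (q t)) (hq0 : ∀ t v, 0 ≤ q t v)
    (hq1 : ∀ t v, q t v ≤ 1 / 2)
    (hP : ∀ t, P[(A t).indicator 1 | ℱ t] =ᵐ[P] q t) {ε : ℝ} (hε : 0 < ε)
    (hfreq : ∀ᵐ v ∂P, ∃ᶠ t in atTop, ε < q t v) :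
    ∫⁻ v, (totalUpcrossings (wager A q a b) a b v : ℝ≥0∞) ∂P = ENNReal.ofReal (a / (b - a)) := by
  have hba : 0 < b - a := by linarith
  have hmeas : ∀ t, Measurable fun v =>
      ((crossingCount (wager A q a b) a b v t / 2 : ℕ) : ℝ≥0∞) := fun t =>
    (Measurable.of_discrete (f := fun n : ℕ => ((n / 2 : ℕ) : ℝ≥0∞))).comp
      ((measurable_wager_crossingCount hA hq t).2.mono (ℱ.le t) le_rfl)
  have hmono : Monotone fun t v =>
      ((crossingCount (wager A q a b) a b v t / 2 : ℕ) : ℝ≥0∞) := fun s t hst v =>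
    Nat.cast_le.2 (Nat.div_le_div_right (crossingCount_mono _ _ _ _ hst))
  have hval : ∀ t, ∫⁻ v, ((crossingCount (wager A q a b) a b v t / 2 : ℕ) : ℝ≥0∞) ∂P =
      ENNReal.ofReal ((a - ∫ v, wagerRemainder A q a b t v ∂P) / (b - a)) := by
    intro t
    have h1 := integral_upcrossings_add_integral_wagerRemainder (P := P) ha hab hA hq hq0 hq1 hP t
    rw [← eq_sub_iff_add_eq] at h1
    rw [← h1, mul_div_cancel_left₀ _ hba.ne',
      ofReal_integral_eq_lintegral_ofReal (integrable_upcrossings hA hq t)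
        (ae_of_all _ fun v => Nat.cast_nonneg _)]
    simp
  have hU : ∫⁻ v, (totalUpcrossings (wager A q a b) a b v : ℝ≥0∞) ∂P =
      ⨆ t, ∫⁻ v, ((crossingCount (wager A q a b) a b v t / 2 : ℕ) : ℝ≥0∞) ∂P := by
    simp_rw [totalUpcrossings_toENNReal]
    exact lintegral_iSup hmeas hmono
  -- The nonnegative remainder already yields `≤`; this finiteness is what bounds the number of
  -- crossings almost surely.
  have hfin : ∫⁻ v, ⨆ t, ((crossingCount (wager A q a b) a b v t / 2 : ℕ) : ℝ≥0∞) ∂P ≠ ∞ := by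
    rw [lintegral_iSup hmeas hmono]
    refine ne_top_of_le_ne_top ENNReal.ofReal_ne_top (b := ENNReal.ofReal (a / (b - a)))
      (iSup_le fun t => ?_)
    rw [hval]
    refine ENNReal.ofReal_le_ofReal (div_le_div_of_nonneg_right ?_ hba.le)
    have : 0 ≤ ∫ v, wagerRemainder A q a b t v ∂P := integral_nonneg fun v =>
      (wagerRemainder_mem_Icc (A := A) ha hab hq0 hq1 t v).1
    linarith
  have hrem : ∀ᵐ v ∂P, Tendsto (fun t => wagerRemainder A q a b t v) atTop (nhds 0) := by
    filter_upwards [ae_lt_top (Measurable.iSup hmeas) hfin,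
      ae_frequently_mem_of_frequently_lt hA hq0 hP hε hfreq] with v h1 h2
    obtain ⟨n, hn⟩ := ENNReal.exists_nat_gt h1.ne
    refine wagerRemainder_tendsto_zero ha hab hq1 h2 (n := 2 * n + 1) fun t => ?_
    have : ((crossingCount (wager A q a b) a b v t / 2 : ℕ) : ℝ≥0∞) < n :=
      (le_iSup (fun t => ((crossingCount (wager A q a b) a b v t / 2 : ℕ) : ℝ≥0∞)) t).trans_lt hn
    have := Nat.cast_lt.1 this
    omega
  have hlim : Tendsto (fun t => ∫ v, wagerRemainder A q a b t v ∂P) atTop (nhds 0) := by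
    have h := tendsto_integral_of_dominated_convergence (μ := P) (fun _ => b)
      (fun t => (integrable_wagerRemainder ha hab hA hq hq0 hq1 t).aestronglyMeasurable)
      (integrable_const b) (fun t => ae_of_all _ fun v => by
        have h := wagerRemainder_mem_Icc (A := A) ha hab hq0 hq1 t v
        rw [Real.norm_of_nonneg h.1]
        exact h.2) hrem
    simpa using h
  have hlim' := ENNReal.tendsto_ofReal ((hlim.const_sub a).div_const (b - a))
  rw [sub_zero] at hlim'
  rw [hU]
  refine tendsto_nhds_unique (tendsto_atTop_iSup fun s t hst => lintegral_mono (hmono hst)) ?_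
  simp_rw [hval]
  exact hlim'

end WagerUpcrossings

/-! ### Conditional probabilities of the next character -/

namespace InfString

variable {S : Type*}

@[simp]
theorem length_take (v : InfString S) (t : ℕ) : (v.take t).length = t := by simp [take]

theorem mem_cylinder_take (v : InfString S) (t : ℕ) : v ∈ cylinder (v.take t) := by
  simp [cylinder]

/-- `v.drop m` is `v` without its first `m` characters. -/
def drop (v : InfString S) (m : ℕ) : InfString S := fun i => v (m + i)

theorem take_append_take_drop (v : InfString S) (m n : ℕ) :
    v.take m ++ (v.drop m).take n = v.take (m + n) := by
  induction n with
  | zero => simp [take]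
  | succ n ih => rw [take_succ, ← List.append_assoc, ih, ← add_assoc, take_succ, drop]

theorem setOf_take_eq (t : ℕ) (u : List S) :
    {v : InfString S | v.take t = u} = if u.length = t then cylinder u else ∅ := by
  split_ifs with h
  · subst h; rfl
  · ext v
    simp only [Set.mem_ofPred_eq, Set.mem_empty_iff_false, iff_false]
    rintro rfl
    exact h (length_take v t)

theorem cylinder_append_singleton (u : List S) (x : S) :
    cylinder (u ++ [x]) = cylinder u ∩ {v | v u.length ∈ ({x} : Set S)} := by
  ext v
  simp [cylinder, take_succ]

theorem measurable_take [Finite S] (t : ℕ) :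
    @Measurable _ _ (filtration S t) ⊤ fun v : InfString S => v.take t := by
  let _ : MeasurableSpace (List S) := ⊤
  refine @measurable_to_countable' _ _ _ _ (filtration S t) _ fun u => ?_
  have : (fun v : InfString S => v.take t) ⁻¹' {u} = {v | v.take t = u} := rfl
  rw [this, setOf_take_eq]
  split_ifs with h
  · exact MeasurableSpace.measurableSet_generateFrom ⟨u, h, rfl⟩
  · exact @MeasurableSet.empty _ (filtration S t)

theorem measurable_comp_take [Finite S] {β : Type*} [MeasurableSpace β] (f : List S → β) (t : ℕ) :
    Measurable[filtration S t] fun v : InfString S => f (v.take t) :=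
  @Measurable.comp _ _ _ (filtration S t) ⊤ _ _ _ measurable_from_top (measurable_take t)

theorem measurableSet_take_mem [Finite S] (D : Set (List S)) (t : ℕ) :
    MeasurableSet[filtration S t] {v : InfString S | v.take t ∈ D} :=
  measurable_take t (MeasurableSpace.measurableSet_top (s := D))

/-- The generating cylinders are preimages of singletons under `take t`. -/
theorem exists_of_measurableSet [Finite S] {t : ℕ} {s : Set (InfString S)}
    (hs : MeasurableSet[filtration S t] s) : ∃ D : Set (List S), s = {v | v.take t ∈ D} := by
  have hle : (filtration S t : MeasurableSpace (InfString S)) ≤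
      MeasurableSpace.comap (fun v => v.take t) ⊤ := by
    refine MeasurableSpace.generateFrom_le ?_
    rintro _ ⟨u, rfl, rfl⟩
    exact ⟨{u}, MeasurableSpace.measurableSet_top, rfl⟩
  obtain ⟨D, -, hD⟩ := hle s hs
  exact ⟨D, hD.symm⟩

/-- The next character after the first `t` ones lies in the set selected by `C`. -/
def nextEvent (C : List S → Set S) (t : ℕ) : Set (InfString S) := {v | v t ∈ C (v.take t)}

theorem measurableSet_nextEvent [Finite S] (C : List S → Set S) (t : ℕ) :
    MeasurableSet[filtration S (t + 1)] (nextEvent C t) := by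
  convert measurableSet_take_mem {l | ∃ u x, l = u ++ [x] ∧ x ∈ C u} (t + 1) using 1
  ext v
  simp only [nextEvent, Set.mem_ofPred_eq, take_succ]
  constructor
  · intro h
    exact ⟨_, _, rfl, h⟩
  · rintro ⟨u, x, h, hx⟩
    obtain ⟨h1, h2⟩ := List.append_inj' h rfl
    rw [h1]
    rwa [List.singleton_inj.1 h2]

theorem measurableSet_apply_mem [Finite S] (t : ℕ) (D : Set S) :
    MeasurableSet {v : InfString S | v t ∈ D} :=
  (filtration S).le _ _ (measurableSet_nextEvent (fun _ => D) t)

theorem measurableSet_cylinder [Finite S] (u : List S) : MeasurableSet (cylinder u) :=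
  (filtration S).le u.length _ (measurableSet_take_mem {u} u.length)

/-- The conditional probability, given the prefix `u`, that the next character lies in `D`. -/
noncomputable def nextProb (P : Measure (InfString S)) (u : List S) (D : Set S) : ℝ :=
  (P[|cylinder u]).real {v | v u.length ∈ D}

theorem cond_cylinder_append [Finite S] (P : Measure (InfString S)) (u : List S) (x : S) :
    (P[|cylinder u]).real (cylinder (u ++ [x])) = nextProb P u {x} := by
  rw [nextProb, measureReal_def, measureReal_def, cond_apply (measurableSet_cylinder u),
    cond_apply (measurableSet_cylinder u), cylinder_append_singleton, ← Set.inter_assoc,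
    Set.inter_self]

/-- Every set in `filtration S t` is a countable union of fibres of `take t`, so integrals need
comparing on single cylinders only. -/
theorem condExp_nextEvent [Finite S] (P : Measure (InfString S)) [IsProbabilityMeasure P]
    (C : List S → Set S) (t : ℕ) :
    P[(nextEvent C t).indicator 1 | filtration S t] =ᵐ[P]
      fun v => nextProb P (v.take t) (C (v.take t)) := by
  have hA := (filtration S).le _ _ (measurableSet_nextEvent C t)
  have hle := (filtration S).le t
  have hqm := measurable_comp_take (fun u => nextProb P u (C u)) t
  have hIA : Integrable ((nextEvent C t).indicator (1 : InfString S → ℝ)) P :=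
    (integrable_const (1 : ℝ)).indicator hA
  have hIq : Integrable (fun v : InfString S => nextProb P (v.take t) (C (v.take t))) P :=
    Integrable.of_bound (hqm.mono hle le_rfl).aestronglyMeasurable 1 (ae_of_all _ fun v => by
      rw [nextProb, Real.norm_of_nonneg measureReal_nonneg]
      exact measureReal_le_one)
  refine (ae_eq_condExp_of_forall_setIntegral_eq hle hIA (fun s _ _ => hIq.integrableOn) ?_
    hqm.stronglyMeasurable.aestronglyMeasurable).symm
  intro s hs _
  obtain ⟨D, rfl⟩ := exists_of_measurableSet hs
  have hU : {v : InfString S | v.take t ∈ D} =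
      ⋃ u : D, {v : InfString S | v.take t = (u : List S)} := by
    ext v; simp
  have hfib : ∀ u : List S, MeasurableSet {v : InfString S | v.take t = u} := fun u =>
    hle _ (measurableSet_take_mem {u} t)
  have hdisj : Pairwise (Function.onFun Disjoint
      fun u : D => {v : InfString S | v.take t = (u : List S)}) := by
    intro u u' huu
    refine Set.disjoint_left.2 fun v h1 h2 => huu (Subtype.ext ?_)
    exact (Eq.symm h1).trans h2
  rw [hU, integral_iUnion (fun u : D => hfib u) hdisj hIq.integrableOn,
    integral_iUnion (fun u : D => hfib u) hdisj hIA.integrableOn]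
  refine tsum_congr fun u => ?_
  obtain ⟨u, -⟩ := u
  rw [setIntegral_congr_fun (g := fun _ => nextProb P u (C u)) (hfib u)
    (fun v (hv : v.take t = u) => by simp only [hv]), setIntegral_const,
    integral_indicator_one hA, measureReal_restrict_apply hA]
  have h1 : nextEvent C t ∩ {v | v.take t = u} = {v | v.take t = u} ∩ {v | v t ∈ C u} := by
    ext v
    simp only [nextEvent, Set.mem_inter_iff, Set.mem_ofPred_eq]
    constructor
    · rintro ⟨h, rfl⟩; exact ⟨rfl, h⟩
    · rintro ⟨rfl, h⟩; exact ⟨h, rfl⟩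
  dsimp only
  rw [h1, setOf_take_eq]
  split_ifs with hu
  · subst hu
    -- The product formula also holds on a null cylinder, where both sides are `0`.
    rw [nextProb, smul_eq_mul, mul_comm, measureReal_def, measureReal_def, measureReal_def,
      ← ENNReal.toReal_mul, cond_mul_eq_inter (measurableSet_cylinder u)]
  · simp

theorem nextProb_compl [Finite S] (P : Measure (InfString S)) [IsProbabilityMeasure P] {u : List S}
    (hu : 0 < P (cylinder u)) (D : Set S) : nextProb P u Dᶜ = 1 - nextProb P u D := by
  have := cond_isProbabilityMeasure hu.ne'
  exact probReal_compl_eq_one_sub (measurableSet_apply_mem u.length D)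

/-- There are only countably many null cylinders. -/
theorem ae_forall_cylinder_take_pos [Finite S] (P : Measure (InfString S)) :
    ∀ᵐ v ∂P, ∀ n, 0 < P (cylinder (v.take n)) := by
  have h : ∀ᵐ v ∂P, ∀ u : List S, P (cylinder u) = 0 → v ∉ cylinder u := by
    refine ae_all_iff.2 fun u => ?_
    by_cases hu : P (cylinder u) = 0
    · exact (measure_eq_zero_iff_ae_notMem.1 hu).mono fun v hv _ => hv
    · exact ae_of_all _ fun v h => absurd h hu
  filter_upwards [h] with v hv n
  exact pos_iff_ne_zero.2 fun h0 => hv _ h0 (mem_cylinder_take v n)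

/-- Perpetual entropy allows to select events on the next character whose conditional probability
is at most `1 / 2` and almost surely infinitely often bounded away from `0`. -/
theorem HasPerpetualEntropy.exists_nextProb [Finite S] {P : Measure (InfString S)}
    [IsProbabilityMeasure P] (hP : HasPerpetualEntropy P) :
    ∃ (ε : ℝ) (C : List S → Set S), 0 < ε ∧ (∀ u, nextProb P u (C u) ≤ 1 / 2) ∧
      ∀ᵐ v ∂P, ∃ᶠ t in atTop, ε < nextProb P (v.take t) (C (v.take t)) := by
  obtain ⟨ε, hε, h⟩ := hP
  have hC : ∀ u : List S, ∃ D : Set S, nextProb P u D ≤ 1 / 2 ∧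
      ((∃ D', ε < nextProb P u D' ∧ nextProb P u D' ≤ 1 / 2) → ε < nextProb P u D) := by
    intro u
    by_cases hD : ∃ D', ε < nextProb P u D' ∧ nextProb P u D' ≤ 1 / 2
    · obtain ⟨D, h1, h2⟩ := hD
      exact ⟨D, h2, fun _ => h1⟩
    -- The empty event has probability `0`: no effective bet at this prefix.
    · exact ⟨∅, by simp [nextProb], fun h => absurd h hD⟩
  choose C hC1 hC2 using hC
  refine ⟨ε, C, hε, hC1, ?_⟩
  filter_upwards [ae_forall_cylinder_take_pos P] with v hv
  refine frequently_atTop.2 fun N => ?_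
  -- Starting from the prefix of length `N` forces the position found to be at least `N`.
  obtain ⟨x, t, h1, h2⟩ := h (v.take N) (v.drop N) fun n => by
    rw [take_append_take_drop]; exact hv _
  rw [take_append_take_drop, cond_cylinder_append] at h1 h2
  refine ⟨N + t, Nat.le_add_right _ _, hC2 _ ?_⟩
  -- Either the symbol or its complement has probability at most `1/2`; the bound `1 - ε` keeps the
  -- complement above `ε`.
  by_cases hx : nextProb P (v.take (N + t)) {x} ≤ 1 / 2
  · exact ⟨{x}, h1, hx⟩
  · refine ⟨{x}ᶜ, ?_, ?_⟩ <;> rw [nextProb_compl P (hv _)] <;> linarith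

end InfString

theorem mainTheorem10 {S : Type*} [Finite S] [Nontrivial S]
    (P : Measure (InfString S)) [IsProbabilityMeasure P] (hP : InfString.HasPerpetualEntropy P)
    (a b : ℝ) (ha : 0 < a) (hab : a < b) :
    ∃ X : ℕ → InfString S → ℝ,
      Martingale X (InfString.filtration S) P ∧
      (∀ t v, 0 ≤ X t v) ∧
      (∀ v, X 0 v = a) ∧
      ∫⁻ v, (totalUpcrossings X a b v : ℝ≥0∞) ∂P = ENNReal.ofReal (a / (b - a)) := by
  obtain ⟨ε, C, hε, hC, hfreq⟩ := hP.exists_nextProb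
  let q : ℕ → InfString S → ℝ := fun t v => InfString.nextProb P (v.take t) (C (v.take t))
  have hA := InfString.measurableSet_nextEvent C
  have hq : ∀ t, Measurable[InfString.filtration S t] (q t) := fun t =>
    InfString.measurable_comp_take (fun u => InfString.nextProb P u (C u)) t
  have hq0 : ∀ t v, 0 ≤ q t v := fun t v => measureReal_nonneg
  have hq1 : ∀ t v, q t v ≤ 1 / 2 := fun t v => hC _
  have hcond := InfString.condExp_nextEvent P C
  exact ⟨wager (InfString.nextEvent C) q a b, martingale_wager ha hab hA hq hq0 hq1 hcond,
    wager_nonneg ha hab hq0 hq1, fun v => rfl,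
    lintegral_totalUpcrossings_wager ha hab hA hq hq0 hq1 hcond hε hfreq⟩
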